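/- For $n\ge 2$ let $VT_n$ be the virtual twin group, i.e. the group generated by $s_1,\dots,s_{n-1},\rho_1,\dots,\rho_{n-1}$ subject to the defining relations $s_i^2=\rho_i^2=1$ for $1\le i\le n-1$; $s_is_j=s_js_i$, $\rho_i\rho_j=\rho_j\rho_i$, $s_i\rho_j=\rho_js_i$ for $|i-j|\ge 2$; and $\rho_i\rho_j\rho_i=\rho_j\rho_i\rho_j$, $\rho_is_j\rho_i=\rho_js_i\rho_j$ for $|i-j|=1$. Let $VT_n'$ denote its commutator subgroup. Then the following hold. 1. $VT_2'\cong\mathbb{Z}$, and it is generated by $(\rho_1s_1)^2$. 2. $VT_3'\cong\mathbb{Z}_3*\mathbb{Z}_3*\mathbb{Z}$, and it has the presentation $$\big\langle \rho_2\rho_1,\ s_1\rho_2\rho_1s_1,\ (\rho_1s_1)^2 \;\big|\; (\rho_2\rho_1)^3=(s_1\rho_2\rho_1s_1)^3=1\big\rangle .$$ 3. For $n\ge 4$, put $x_i=\rho_i\rho_1$ for $2\le i\le n-1$, $z=s_1\rho_2\rho_1s_1$ and $w=(\rho_1s_1)^2$. Then $VT_n'$ has a presentation with generators $x_2,\dots,x_{n-1},z,w$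 and defining relations \begin{align*} x_2^3&=1,\\ x_j^2&=1 && \text{for } 3\le j\le n-1,\\ z^3&=1,\\ (x_ix_{i+1}^{-1})^3&=1 && \text{for } 2\le i\le n-2,\\ (x_ix_j^{-1})^2&=1 && \text{for } 2\le i\le n-2 \text{ and } i+2\le j\le n-1,\\ (x_jw)^2&=1 && \text{for } 3\le j\le n-1,\\ (zw^{-1}x_3^{-1})^3&=1,\\ (zw^{-1}x_j^{-1})^2&=1 && \text{for } 4\le j\le n-1,\\ (zw^{-1}x_3^{-1}z^{-1}x_2x_3x_2^{-1})^2&=1,\\ (wz^{-1}x_3wzw^{-1}x_2^{-1}x_3^{-1}x_2)^2&=1. \end{align*} -/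

import Mathlib

/-- Generators `s_i`, `ρ_i` (`1 ≤ i ≤ n - 1`) of the virtual twin group. -/
inductive VTGen (n : ℕ) : Type
  | s (i : {i : ℕ // 1 ≤ i ∧ i < n}) : VTGen n
  | ρ (i : {i : ℕ // 1 ≤ i ∧ i < n}) : VTGen n

/-- The letter `s_i` of the free group. -/
def VTGen.S {n : ℕ} (i : {i : ℕ // 1 ≤ i ∧ i < n}) : FreeGroup (VTGen n) :=
  FreeGroup.of (VTGen.s i)

/-- The letter `ρ_i` of the free group. -/
def VTGen.R {n : ℕ} (i : {i : ℕ // 1 ≤ i ∧ i < n}) : FreeGroup (VTGen n) :=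
  FreeGroup.of (VTGen.ρ i)

open VTGen in
/-- The defining relators of the virtual twin group; a relation `u = v` gives the relator
`u * v⁻¹`. -/
inductive IsVTRelator (n : ℕ) : FreeGroup (VTGen n) → Prop
  | s_sq (i : {i : ℕ // 1 ≤ i ∧ i < n}) : IsVTRelator n (S i ^ 2)
  | ρ_sq (i : {i : ℕ // 1 ≤ i ∧ i < n}) : IsVTRelator n (R i ^ 2)
  | s_comm (i j : {i : ℕ // 1 ≤ i ∧ i < n}) (h : 2 ≤ |((i : ℕ) : ℤ) - ((j : ℕ) : ℤ)|) :
      IsVTRelator n (S i * S j * (S j * S i)⁻¹)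
  | ρ_comm (i j : {i : ℕ // 1 ≤ i ∧ i < n}) (h : 2 ≤ |((i : ℕ) : ℤ) - ((j : ℕ) : ℤ)|) :
      IsVTRelator n (R i * R j * (R j * R i)⁻¹)
  | sρ_comm (i j : {i : ℕ // 1 ≤ i ∧ i < n}) (h : 2 ≤ |((i : ℕ) : ℤ) - ((j : ℕ) : ℤ)|) :
      IsVTRelator n (S i * R j * (R j * S i)⁻¹)
  | ρ_braid (i j : {i : ℕ // 1 ≤ i ∧ i < n}) (h : |((i : ℕ) : ℤ) - ((j : ℕ) : ℤ)| = 1) :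
      IsVTRelator n (R i * R j * R i * (R j * R i * R j)⁻¹)
  | mixed (i j : {i : ℕ // 1 ≤ i ∧ i < n}) (h : |((i : ℕ) : ℤ) - ((j : ℕ) : ℤ)| = 1) :
      IsVTRelator n (R i * S j * R i * (R j * S i * R j)⁻¹)

/-- The virtual twin group `VT_n`. -/
abbrev VT (n : ℕ) : Type :=
  PresentedGroup {r : FreeGroup (VTGen n) | IsVTRelator n r}

/-- The element `s_i` of `VT_n`, for `1 ≤ i ≤ n - 1`. -/
def VT.s {n : ℕ} (i : ℕ) (h : 1 ≤ i ∧ i < n := by omega) : VT n :=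
  PresentedGroup.of (VTGen.s ⟨i, h⟩)

/-- The element `ρ_i` of `VT_n`, for `1 ≤ i ≤ n - 1`. -/
def VT.ρ {n : ℕ} (i : ℕ) (h : 1 ≤ i ∧ i < n := by omega) : VT n :=
  PresentedGroup.of (VTGen.ρ ⟨i, h⟩)

/-- The subgroup `H` of `G` has the presentation `⟨α ∣ rels⟩`, where the abstract generator `a`
stands for the element `g a` of `G`. -/
def Subgroup.HasPresentation {G : Type*} [Group G] (H : Subgroup G) {α : Type*} (g : α → G)
    (rels : Set (FreeGroup α)) : Prop :=
  ∃ e : PresentedGroup rels ≃* H, ∀ a : α, ((e (PresentedGroup.of a) : H) : G) = g a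

/-- The generating symbols `x_i` (`2 ≤ i ≤ n - 1`), `z`, `w` for the commutator subgroup. -/
inductive VTCommGen (n : ℕ) : Type
  | x (i : {i : ℕ // 2 ≤ i ∧ i < n}) : VTCommGen n
  | z : VTCommGen n
  | w : VTCommGen n

namespace VTCommGen

/-- The letter `x_i` of the free group, for `2 ≤ i ≤ n - 1`. -/
def X {n : ℕ} (i : ℕ) (h : 2 ≤ i ∧ i < n := by omega) : FreeGroup (VTCommGen n) :=
  FreeGroup.of (x ⟨i, h⟩)

/-- The letter `z` of the free group. -/
def Z {n : ℕ} : FreeGroup (VTCommGen n) := FreeGroup.of z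

/-- The letter `w` of the free group. -/
def W {n : ℕ} : FreeGroup (VTCommGen n) := FreeGroup.of w

/-- The elements of `VT_n` for which the symbols stand:
`x_i = ρ_i ρ_1`, `z = s_1 ρ_2 ρ_1 s_1`, `w = (ρ_1 s_1)²`. -/
def toVT (n : ℕ) (hn : 3 ≤ n) : VTCommGen n → VT n
  | x ⟨i, _⟩ => VT.ρ i * VT.ρ 1
  | z => VT.s 1 * VT.ρ 2 * VT.ρ 1 * VT.s 1
  | w => (VT.ρ 1 * VT.s 1) ^ 2

/-- The ten families of relators, for `n ≥ 4`. -/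
inductive IsRelator (n : ℕ) (hn : 4 ≤ n) : FreeGroup (VTCommGen n) → Prop
  | rel1 : IsRelator n hn (X 2 ^ 3)
  | rel2 (j : ℕ) (h3 : 3 ≤ j) (hj : j < n) : IsRelator n hn (X j ^ 2)
  | rel3 : IsRelator n hn (Z ^ 3)
  | rel4 (i : ℕ) (h2 : 2 ≤ i) (hi : i + 1 < n) :
      IsRelator n hn ((X i * (X (i + 1))⁻¹) ^ 3)
  | rel5 (i j : ℕ) (h2 : 2 ≤ i) (hij : i + 2 ≤ j) (hj : j < n) :
      IsRelator n hn ((X i * (X j)⁻¹) ^ 2)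
  | rel6 (j : ℕ) (h3 : 3 ≤ j) (hj : j < n) : IsRelator n hn ((X j * W) ^ 2)
  | rel7 : IsRelator n hn ((Z * W⁻¹ * (X 3)⁻¹) ^ 3)
  | rel8 (j : ℕ) (h4 : 4 ≤ j) (hj : j < n) : IsRelator n hn ((Z * W⁻¹ * (X j)⁻¹) ^ 2)
  | rel9 : IsRelator n hn ((Z * W⁻¹ * (X 3)⁻¹ * Z⁻¹ * X 2 * X 3 * (X 2)⁻¹) ^ 2)
  | rel10 : IsRelator n hn
      ((W * Z⁻¹ * X 3 * W * Z * W⁻¹ * (X 2)⁻¹ * (X 3)⁻¹ * X 2) ^ 2)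

end VTCommGen

/-! The idea is to build the coset action of `VT n` on its commutator subgroup by hand, starting
from the candidate presentation. Conjugating `s_1` by products of the `ρ_i` produces every other
`s_i`, so to map `VT n` into a group it is enough to check a short list of relations in `s_1` and
the `ρ_i` (`ReducedRelations.lift`). The signs of `s_1` and of the `ρ_i` give a map onto a group of
order four, and the elements `s_1^b ρ_1^a` represent the cosets of its kernel.

Let `K` be the candidate group. Writing elements of `VT n` as `s_1^b ρ_1^a k`, left multiplication
by `s_1` toggles `b`, while `ρ_i` toggles `a` and multiplies `k` by a power `±1` of `x_i = ρ_i ρ_1`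
if `b = 0`, or of `u_i = s_1 ρ_i s_1 ρ_1` if `b = 1`. These formulas define an action on `Bool ×
Bool × K` as soon as `CosetRelations` hold in `K`. The map `φ : K → VT n` is then injective, because
`φ k` carries the base point to `(0, 0, k)`. Its image is the commutator subgroup, because
commutators preserve the labels (`CosetRelations.injective_and_range_eq`). With `u_1 = w⁻¹`, `u_2 =
z w⁻¹` and `u_j = x_j` for `j ≥ 3`, the `CosetRelations` become exactly the stated relators. -/

namespace VT

/-! ### Homomorphisms out of `VT n` from relations in `s_1` and the `ρ_i` -/

/-- The images `s_i` of the remaining generators, obtained from `s_1 = a` by conjugation. -/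
def conjSeq {G : Type*} [Group G] (a : G) (r : ℕ → G) : ℕ → G
  | 0 => a
  | 1 => a
  | (i + 2) => (r (i + 1) * r (i + 2)) * conjSeq a r (i + 1) * (r (i + 1) * r (i + 2))⁻¹

theorem conjSeq_succ {G : Type*} [Group G] (a : G) (r : ℕ → G) (i : ℕ) (hi : 1 ≤ i) :
    conjSeq a r (i + 1) = (r i * r (i + 1)) * conjSeq a r i * (r i * r (i + 1))⁻¹ := by
  obtain ⟨i, rfl⟩ := Nat.exists_eq_add_of_le' hi
  rfl

/-- Elements `a`, `r_1, …, r_{n-1}` satisfying the relations of `VT_n` in the generators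
`s_1`, `ρ_1, …, ρ_{n-1}`. -/
structure ReducedRelations (n : ℕ) {G : Type*} [Group G] (a : G) (r : ℕ → G) : Prop where
  a_sq : a * a = 1
  r_sq : ∀ i, 1 ≤ i → i < n → r i * r i = 1
  r_comm : ∀ i j, 1 ≤ i → i + 2 ≤ j → j < n → Commute (r i) (r j)
  r_braid : ∀ i, 1 ≤ i → i + 1 < n → r i * r (i + 1) * r i = r (i + 1) * r i * r (i + 1)
  ar_comm : ∀ j, 3 ≤ j → j < n → Commute a (r j)
  aa_comm : 4 ≤ n → Commute a ((r 2 * r 3 * (r 1 * r 2)) * a * (r 2 * r 3 * (r 1 * r 2))⁻¹)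

namespace ReducedRelations

variable {n : ℕ} {G : Type*} [Group G] {a : G} {r : ℕ → G}

theorem conjSeq_sq (h : ReducedRelations n a r) (i : ℕ) (hi : 1 ≤ i) :
    conjSeq a r i * conjSeq a r i = 1 := by
  induction i, hi using Nat.le_induction with
  | base => exact h.a_sq
  | succ i hi ih =>
    rw [conjSeq_succ a r i hi]
    simp only [← MulAut.conj_apply, ← map_mul, ih, map_one]

theorem commute_conjSeq_of_lt (h : ReducedRelations n a r) (i j : ℕ) (hi : 1 ≤ i)
    (hij : i + 2 ≤ j) (hj : j < n) : Commute (conjSeq a r i) (r j) := by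
  induction i, hi using Nat.le_induction with
  | base => exact h.ar_comm j hij hj
  | succ i hi ih =>
    rw [conjSeq_succ a r i hi]
    have h1 : Commute (r i * r (i + 1)) (r j) :=
      (h.r_comm i j hi (by omega) hj).mul_left (h.r_comm (i + 1) j (by omega) (by omega) hj)
    exact (h1.mul_left (ih (by omega))).mul_left h1.inv_left

theorem commute_conjSeq_of_gt (h : ReducedRelations n a r) (i j : ℕ) (hj : 1 ≤ j)
    (hij : j + 2 ≤ i) (hi : i < n) : Commute (conjSeq a r i) (r j) := by
  induction i, hij using Nat.le_induction with
  | base =>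
    rw [conjSeq_succ a r (j + 1) (by omega), conjSeq_succ a r j hj]
    set c := r (j + 1) * r (j + 1 + 1) * (r j * r (j + 1)) with hc
    have hcomm := h.commute_conjSeq_of_lt j (j + 2) hj le_rfl hi
    -- `c` conjugates `conjSeq a r j` to `conjSeq a r (j + 2)` and `r (j + 2)` to `r j`, so it
    -- carries the known commutation `hcomm` to the required one.
    have e : c * r (j + 2) = r j * c := by
      have b1 := h.r_braid j hj (by omega)
      have b2 := h.r_braid (j + 1) (by omega) (by omega)
      have b3 := h.r_comm j (j + 2) hj le_rfl hi
      calc c * r (j + 2)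
          = r (j + 1) * (r (j + 2) * r j) * r (j + 1) * r (j + 2) := by simp only [hc, mul_assoc]
        _ = r (j + 1) * r j * (r (j + 2) * r (j + 1) * r (j + 2)) := by
            rw [← b3.eq]; simp only [mul_assoc]
        _ = (r (j + 1) * r j * r (j + 1)) * r (j + 2) * r (j + 1) := by
            rw [← b2]; simp only [mul_assoc]
        _ = r j * r (j + 1) * (r j * r (j + 2)) * r (j + 1) := by
            rw [← b1]; simp only [mul_assoc]
        _ = r j * c := by rw [b3.eq]; simp only [hc, mul_assoc]
    have e' : r j = c * r (j + 2) * c⁻¹ := by rw [e]; simp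
    have := (Commute.conj_iff c).2 hcomm
    rw [← e'] at this
    convert this using 1
    simp only [hc, mul_assoc, mul_inv_rev]
  | succ i hij ih =>
    rw [conjSeq_succ a r i (by omega)]
    have h1 : Commute (r i * r (i + 1)) (r j) :=
      (h.r_comm j i hj (by omega) (by omega)).symm.mul_left
        (h.r_comm j (i + 1) hj (by omega) hi).symm
    exact (h1.mul_left (ih (by omega))).mul_left h1.inv_left

/-- Everything reduces to the pair `(1, 3)`, which is `aa_comm`: conjugating by `r j * r (j + 1)`
raises the larger index and fixes the other element, and then the smaller index is raised in the
same way. -/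
theorem commute_conjSeq_conjSeq (h : ReducedRelations n a r) (i j : ℕ) (hi : 1 ≤ i)
    (hij : i + 2 ≤ j) (hj : j < n) : Commute (conjSeq a r i) (conjSeq a r j) := by
  have move (x h : G) (hx : Commute h x) : h * x * h⁻¹ = x := by rw [hx.eq]; simp
  have base : ∀ j, 3 ≤ j → j < n → Commute (conjSeq a r 1) (conjSeq a r j) := by
    intro j hj3
    induction j, hj3 using Nat.le_induction with
    | base =>
      intro hn
      have := h.aa_comm (by omega)
      rw [conjSeq_succ a r 2 (by omega), conjSeq_succ a r 1 (by omega)]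
      simpa only [conjSeq, mul_assoc, mul_inv_rev] using this
    | succ j hj3 ih =>
      intro hn
      rw [conjSeq_succ a r j (by omega)]
      have h1 : Commute (r j * r (j + 1)) (conjSeq a r 1) :=
        ((h.commute_conjSeq_of_lt 1 j le_rfl (by omega) (by omega)).mul_right
          (h.commute_conjSeq_of_lt 1 (j + 1) le_rfl (by omega) (by omega))).symm
      have := (Commute.conj_iff (r j * r (j + 1))).2 (ih (by omega))
      rwa [move _ _ h1] at this
  induction i, hi using Nat.le_induction with
  | base => exact base j hij hj
  | succ i hi ih =>
    rw [conjSeq_succ a r i hi]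
    have h1 : Commute (r i * r (i + 1)) (conjSeq a r j) :=
      ((h.commute_conjSeq_of_gt j i hi (by omega) hj).mul_right
        (h.commute_conjSeq_of_gt j (i + 1) (by omega) (by omega) hj)).symm
    have := (Commute.conj_iff (r i * r (i + 1))).2 (ih (by omega))
    rwa [move _ _ h1] at this

theorem conjSeq_mixed (h : ReducedRelations n a r) (i : ℕ) (hi : 1 ≤ i) (hn : i + 1 < n) :
    r i * conjSeq a r (i + 1) * r i = r (i + 1) * conjSeq a r i * r (i + 1) := by
  have h1 := h.r_sq i hi (by omega)
  have h2 : (r (i + 1))⁻¹ = r (i + 1) := inv_eq_of_mul_eq_one_left (h.r_sq (i + 1) (by omega) hn)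
  have h3 : (r i)⁻¹ = r i := inv_eq_of_mul_eq_one_left h1
  rw [conjSeq_succ a r i hi, mul_inv_rev, h2, h3]
  calc _ = (r i * r i) * (r (i + 1) * conjSeq a r i * r (i + 1)) * (r i * r i) := by
        simp only [mul_assoc]
    _ = _ := by rw [h1]; simp

theorem lift_relator (h : ReducedRelations n a r) (w : FreeGroup (VTGen n))
    (hw : IsVTRelator n w) :
    FreeGroup.lift (fun g : VTGen n => match g with
      | .s i => conjSeq a r i
      | .ρ i => r i) w = 1 := by
  cases hw with
  | s_sq i =>
    simp only [VTGen.S, pow_two, map_mul, FreeGroup.lift_apply_of]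
    exact h.conjSeq_sq i i.2.1
  | ρ_sq i =>
    simp only [VTGen.R, pow_two, map_mul, FreeGroup.lift_apply_of]
    exact h.r_sq i i.2.1 i.2.2
  | s_comm i j hij =>
    simp only [VTGen.S, map_mul, map_inv, FreeGroup.lift_apply_of, mul_inv_eq_one]
    rcases le_abs.1 hij with h' | h'
    · exact (h.commute_conjSeq_conjSeq j i j.2.1 (by omega) i.2.2).symm
    · exact h.commute_conjSeq_conjSeq i j i.2.1 (by omega) j.2.2
  | ρ_comm i j hij =>
    simp only [VTGen.R, map_mul, map_inv, FreeGroup.lift_apply_of, mul_inv_eq_one]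
    rcases le_abs.1 hij with h' | h'
    · exact (h.r_comm j i j.2.1 (by omega) i.2.2).symm
    · exact h.r_comm i j i.2.1 (by omega) j.2.2
  | sρ_comm i j hij =>
    simp only [VTGen.S, VTGen.R, map_mul, map_inv, FreeGroup.lift_apply_of, mul_inv_eq_one]
    rcases le_abs.1 hij with h' | h'
    · exact h.commute_conjSeq_of_gt i j j.2.1 (by omega) i.2.2
    · exact h.commute_conjSeq_of_lt i j i.2.1 (by omega) j.2.2
  | ρ_braid i j hij =>
    simp only [VTGen.R, map_mul, map_inv, FreeGroup.lift_apply_of, mul_inv_eq_one]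
    rcases (abs_eq zero_le_one).1 hij with h' | h'
    · have e : (i : ℕ) = j + 1 := by omega
      have := i.2
      rw [e]
      exact (h.r_braid j j.2.1 (by omega)).symm
    · have e : (j : ℕ) = i + 1 := by omega
      have := j.2
      rw [e]
      exact h.r_braid i i.2.1 (by omega)
  | mixed i j hij =>
    simp only [VTGen.S, VTGen.R, map_mul, map_inv, FreeGroup.lift_apply_of, mul_inv_eq_one]
    rcases (abs_eq zero_le_one).1 hij with h' | h'
    · have e : (i : ℕ) = j + 1 := by omega
      have := i.2
      rw [e]
      exact (h.conjSeq_mixed j j.2.1 (by omega)).symm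
    · have e : (j : ℕ) = i + 1 := by omega
      have := j.2
      rw [e]
      exact h.conjSeq_mixed i i.2.1 (by omega)

/-- Elements satisfying the reduced relations define a homomorphism from `VT_n`. -/
def lift (h : ReducedRelations n a r) : VT n →* G :=
  PresentedGroup.toGroup h.lift_relator

theorem lift_ρ (h : ReducedRelations n a r) (i : ℕ) (hi : 1 ≤ i ∧ i < n) :
    h.lift (VT.ρ i hi) = r i :=
  PresentedGroup.toGroup.of h.lift_relator

theorem lift_s (h : ReducedRelations n a r) (hn : 1 ≤ 1 ∧ 1 < n) :
    h.lift (VT.s 1 hn) = a :=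
  PresentedGroup.toGroup.of h.lift_relator

end ReducedRelations

/-! ### Relations and generators of `VT n` -/

section Relations

variable {n : ℕ}

theorem s_mul_self (i : ℕ) (h : 1 ≤ i ∧ i < n) : s i h * s i h = 1 := by
  have := PresentedGroup.one_of_mem (rels := {r | IsVTRelator n r}) (.s_sq ⟨i, h⟩)
  rw [map_pow, pow_two] at this
  exact this

theorem ρ_mul_self (i : ℕ) (h : 1 ≤ i ∧ i < n) : ρ i h * ρ i h = 1 := by
  have := PresentedGroup.one_of_mem (rels := {r | IsVTRelator n r}) (.ρ_sq ⟨i, h⟩)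
  rw [map_pow, pow_two] at this
  exact this

theorem s_comm (i j : ℕ) (hi : 1 ≤ i ∧ i < n) (hj : 1 ≤ j ∧ j < n) (h : i + 2 ≤ j) :
    Commute (s i hi) (s j hj) := by
  have := PresentedGroup.one_of_mem (rels := {r | IsVTRelator n r})
    (.s_comm ⟨i, hi⟩ ⟨j, hj⟩ (le_abs.2 (by right; push_cast; omega)))
  simp only [map_mul, map_inv, mul_inv_eq_one] at this
  exact this

theorem ρ_comm (i j : ℕ) (hi : 1 ≤ i ∧ i < n) (hj : 1 ≤ j ∧ j < n) (h : i + 2 ≤ j) :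
    Commute (ρ i hi) (ρ j hj) := by
  have := PresentedGroup.one_of_mem (rels := {r | IsVTRelator n r})
    (.ρ_comm ⟨i, hi⟩ ⟨j, hj⟩ (le_abs.2 (by right; push_cast; omega)))
  simp only [map_mul, map_inv, mul_inv_eq_one] at this
  exact this

theorem s_ρ_comm (i j : ℕ) (hi : 1 ≤ i ∧ i < n) (hj : 1 ≤ j ∧ j < n) (h : i + 2 ≤ j) :
    Commute (s i hi) (ρ j hj) := by
  have := PresentedGroup.one_of_mem (rels := {r | IsVTRelator n r})
    (.sρ_comm ⟨i, hi⟩ ⟨j, hj⟩ (le_abs.2 (by right; push_cast; omega)))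
  simp only [map_mul, map_inv, mul_inv_eq_one] at this
  exact this

theorem ρ_braid (i : ℕ) (hi : 1 ≤ i ∧ i < n) (hj : 1 ≤ i + 1 ∧ i + 1 < n) :
    ρ i hi * ρ (i + 1) hj * ρ i hi = ρ (i + 1) hj * ρ i hi * ρ (i + 1) hj := by
  have := PresentedGroup.one_of_mem (rels := {r | IsVTRelator n r})
    (.ρ_braid ⟨i, hi⟩ ⟨i + 1, hj⟩ (by simp))
  simp only [map_mul, map_inv, mul_inv_eq_one] at this
  exact this

theorem mixed (i : ℕ) (hi : 1 ≤ i ∧ i < n) (hj : 1 ≤ i + 1 ∧ i + 1 < n) :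
    ρ i hi * s (i + 1) hj * ρ i hi = ρ (i + 1) hj * s i hi * ρ (i + 1) hj := by
  have := PresentedGroup.one_of_mem (rels := {r | IsVTRelator n r})
    (.mixed ⟨i, hi⟩ ⟨i + 1, hj⟩ (by simp))
  simp only [map_mul, map_inv, mul_inv_eq_one] at this
  exact this

theorem ρ_inv (i : ℕ) (h : 1 ≤ i ∧ i < n) : (ρ i h)⁻¹ = ρ i h :=
  inv_eq_of_mul_eq_one_left (ρ_mul_self i h)

theorem s_inv (i : ℕ) (h : 1 ≤ i ∧ i < n) : (s i h)⁻¹ = s i h :=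
  inv_eq_of_mul_eq_one_left (s_mul_self i h)

theorem s_succ (i : ℕ) (hi : 1 ≤ i ∧ i < n) (hj : 1 ≤ i + 1 ∧ i + 1 < n) :
    s (i + 1) hj = ρ i hi * ρ (i + 1) hj * s i hi * (ρ i hi * ρ (i + 1) hj)⁻¹ := by
  have := mixed i hi hj
  calc s (i + 1) hj = (ρ i hi)⁻¹ * (ρ i hi * s (i + 1) hj * ρ i hi) * (ρ i hi)⁻¹ := by group
    _ = _ := by rw [this, mul_inv_rev, ρ_inv, ρ_inv]; simp only [mul_assoc]

/-- `VT_n` is generated, as a monoid, by `s_1` and the `ρ_i`. -/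
theorem induction_generators (hn : 1 ≤ 1 ∧ 1 < n) {p : VT n → Prop} (one : p 1)
    (s_mul : ∀ g, p g → p (s 1 hn * g))
    (ρ_mul : ∀ i hi g, p g → p (ρ i hi * g)) (g : VT n) : p g := by
  -- The elements whose left multiplication preserves `p`; it remains to see that all generators and
  -- their inverses lie in `M`.
  let M : Submonoid (VT n) :=
    { carrier := {h | ∀ g, p g → p (h * g)}
      one_mem' := by simp
      mul_mem' := fun {x y} hx hy g hg => by rw [mul_assoc]; exact hx _ (hy _ hg) }
  have hs : ∀ i, 1 ≤ i → ∀ hi : 1 ≤ i ∧ i < n, s i hi ∈ M := by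
    intro i h1
    induction i, h1 using Nat.le_induction with
    | base => exact fun _ => s_mul
    | succ i h1 ih =>
      intro hi
      rw [s_succ i ⟨h1, by omega⟩ hi, mul_inv_rev, ρ_inv, ρ_inv]
      have a1 : ρ i ⟨h1, by omega⟩ ∈ M := ρ_mul _ _
      have a2 : ρ (i + 1) hi ∈ M := ρ_mul _ _
      exact M.mul_mem (M.mul_mem (M.mul_mem a1 a2) (ih _)) (M.mul_mem a2 a1)
  have hgen : ∀ v : VTGen n,
      (PresentedGroup.of v : VT n) ∈ M ∧ (PresentedGroup.of v : VT n)⁻¹ ∈ M := by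
    rintro (⟨i, hi⟩ | ⟨i, hi⟩)
    · have := hs i hi.1 hi
      exact ⟨this, by rw [← s_inv] at this; exact this⟩
    · have : ρ i hi ∈ M := ρ_mul i hi
      exact ⟨this, by rw [← ρ_inv] at this; exact this⟩
  have key : g ∈ M := by
    obtain ⟨w, rfl⟩ := PresentedGroup.mk_surjective _ g
    induction w using FreeGroup.induction_on with
    | C1 => exact M.one_mem
    | of v => exact (hgen v).1
    | inv_of v _ => exact (hgen v).2
    | mul x y hx hy => rw [map_mul]; exact M.mul_mem hx hy
  simpa using key 1 one

/-- In the abelianization the braid relation cancels to an equality of neighbouring `ρ_i`, so all of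
them agree with `ρ_1`, an involution. -/
theorem ρ_mul_ρ_one_mem_commutator (hn : 1 ≤ 1 ∧ 1 < n) (i : ℕ) (hi : 1 ≤ i ∧ i < n) :
    ρ i hi * ρ 1 hn ∈ commutator (VT n) := by
  rw [← Abelianization.ker_of, MonoidHom.mem_ker, map_mul]
  have key : ∀ i, 1 ≤ i → ∀ hi : 1 ≤ i ∧ i < n,
      Abelianization.of (ρ i hi) = Abelianization.of (ρ 1 hn) := by
    intro i h1
    induction i, h1 using Nat.le_induction with
    | base => exact fun _ => rfl
    | succ i h1 ih =>
      intro hi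
      have hb := congrArg Abelianization.of (ρ_braid i ⟨h1, by omega⟩ hi)
      simp only [map_mul] at hb
      rw [← ih ⟨h1, by omega⟩]
      rw [mul_right_comm, mul_comm (Abelianization.of (ρ (i + 1) hi)), mul_assoc, mul_assoc] at hb
      simpa using hb.symm
  rw [key i hi.1 hi, ← map_mul, ρ_mul_self, map_one]

end Relations

end VT
-- The coset action on `Bool × Bool × K`
namespace VT

section CosetAction

variable {K : Type*} [Group K]

/-- The permutation of `Bool × Bool × K` by which a generator `ρ_i` acts on cosets. -/
def flip (c : Bool → K) : Equiv.Perm (Bool × Bool × K) :=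
  Function.Involutive.toPerm
    (fun p => (p.1, !p.2.1, (if p.2.1 then c p.1 else (c p.1)⁻¹) * p.2.2))
    (by rintro ⟨b, a, k⟩; cases a <;> simp)

/-- The permutation of `Bool × Bool × K` by which `s_1` acts on cosets. -/
def swap {K : Type*} : Equiv.Perm (Bool × Bool × K) :=
  Function.Involutive.toPerm (fun p => (!p.1, p.2)) (by rintro ⟨b, a, k⟩; simp)

/-- Multiplication by an element depending on the coset. -/
def diag (q : Bool → Bool → K) : Equiv.Perm (Bool × Bool × K) where
  toFun p := (p.1, p.2.1, q p.1 p.2.1 * p.2.2)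
  invFun p := (p.1, p.2.1, (q p.1 p.2.1)⁻¹ * p.2.2)
  left_inv _ := by simp
  right_inv _ := by simp

@[simp] theorem flip_false (c : Bool → K) (b : Bool) (k : K) :
    flip c (b, false, k) = (b, true, (c b)⁻¹ * k) := rfl

@[simp] theorem flip_true (c : Bool → K) (b : Bool) (k : K) :
    flip c (b, true, k) = (b, false, c b * k) := rfl

@[simp] theorem swap_apply {K : Type*} (b a : Bool) (k : K) : swap (b, a, k) = (!b, a, k) := rfl

@[simp] theorem diag_apply (q : Bool → Bool → K) (b a : Bool) (k : K) :
    diag q (b, a, k) = (b, a, q b a * k) := rfl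

@[simp] theorem diag_symm_apply (q : Bool → Bool → K) (b a : Bool) (k : K) :
    (diag q).symm (b, a, k) = (b, a, (q b a)⁻¹ * k) := rfl

theorem mul_inv_symm_of_sq {p q : K} (h : (p * q⁻¹) ^ 2 = 1) : p * q⁻¹ = q * p⁻¹ := by
  rw [pow_two] at h
  simpa using eq_inv_of_mul_eq_one_left h

theorem inv_mul_symm_of_sq {p q : K} (h : (p * q⁻¹) ^ 2 = 1) : p⁻¹ * q = q⁻¹ * p := by
  have := mul_inv_symm_of_sq h
  calc p⁻¹ * q = q⁻¹ * (q * p⁻¹) * q := by group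
    _ = q⁻¹ * p := by rw [← this]; group

theorem mul_inv_mul_of_cube {p q : K} (h : (p * q⁻¹) ^ 3 = 1) :
    p * q⁻¹ * p = q * p⁻¹ * q := by
  have : p * q⁻¹ * p * (q * p⁻¹ * q)⁻¹ = 1 := by
    rw [← h]; simp only [pow_succ, pow_zero, one_mul, mul_inv_rev, inv_inv, mul_assoc]
  exact mul_inv_eq_one.1 this

theorem flip_mul_self (c : Bool → K) : flip c * flip c = 1 := by
  ext1 ⟨b, a, k⟩; cases a <;> simp

theorem swap_mul_self {K : Type*} : (swap : Equiv.Perm (Bool × Bool × K)) * swap = 1 := by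
  ext1 ⟨b, a, k⟩; simp

/-- The labels `a = false` and `a = true` ask for `c d⁻¹` and `c⁻¹ d` to be involutive; these
conditions are equivalent, so one relation for each `b` suffices. -/
theorem flip_commute {c d : Bool → K} (h : ∀ b, (c b * (d b)⁻¹) ^ 2 = 1) :
    Commute (flip c) (flip d) := by
  ext1 ⟨b, a, k⟩
  cases a
  · simp [← mul_assoc, mul_inv_symm_of_sq (h b)]
  · simp [← mul_assoc, inv_mul_symm_of_sq (h b)]

theorem flip_braid {c d : Bool → K} (h : ∀ b, (c b * (d b)⁻¹) ^ 3 = 1) :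
    flip c * flip d * flip c = flip d * flip c * flip d := by
  ext1 ⟨b, a, k⟩
  have e := mul_inv_mul_of_cube (h b)
  have e' := congrArg (·⁻¹) e
  simp only [mul_inv_rev, inv_inv, ← mul_assoc] at e'
  cases a
  · simp [← mul_assoc, e']
  · simp [← mul_assoc, e]

theorem swap_commute_flip {c : Bool → K} (h : c false = c true) :
    Commute swap (flip c) := by
  ext1 ⟨b, a, k⟩
  cases a <;> cases b <;> simp [h]

/-- An even number of flips restores the label `a`, so the word conjugating `s_1` to `s_3` acts by
multiplication alone. -/
theorem flip_four (c₁ c₂ c₃ : Bool → K) :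
    flip c₂ * flip c₃ * (flip c₁ * flip c₂) =
      diag fun b a => if a then (c₂ b)⁻¹ * c₃ b * (c₁ b)⁻¹ * c₂ b
        else c₂ b * (c₃ b)⁻¹ * c₁ b * (c₂ b)⁻¹ := by
  ext1 ⟨b, a, k⟩
  cases a <;> simp [mul_assoc]

/-- The conjugate of `swap` multiplies by `q (!b) a * (q b a)⁻¹` while toggling `b`. The two values
of `a` give separate conditions, which is why commutation of `s_1` with `s_3` contributes two
relators. -/
theorem swap_commute_conj_diag {q : Bool → Bool → K}
    (h : ∀ a, (q true a * (q false a)⁻¹) ^ 2 = 1) :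
    Commute swap (diag q * swap * (diag q)⁻¹) := by
  ext1 ⟨b, a, k⟩
  have := mul_inv_symm_of_sq (h a)
  cases b <;> simp [← mul_assoc, this]

/-- The relations among the values `x_i`, `u_i` of the coset action of `ρ_i` which make it
an action of `VT_n`. -/
structure CosetRelations (n : ℕ) (x u : ℕ → K) : Prop where
  x_one : x 1 = 1
  x_eq_u : ∀ j, 3 ≤ j → j < n → x j = u j
  x_sq : ∀ i j, 1 ≤ i → i + 2 ≤ j → j < n → (x i * (x j)⁻¹) ^ 2 = 1
  u_sq : ∀ i j, 1 ≤ i → i + 2 ≤ j → j < n → (u i * (u j)⁻¹) ^ 2 = 1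
  x_cube : ∀ i, 1 ≤ i → i + 1 < n → (x i * (x (i + 1))⁻¹) ^ 3 = 1
  u_cube : ∀ i, 1 ≤ i → i + 1 < n → (u i * (u (i + 1))⁻¹) ^ 3 = 1
  even : 4 ≤ n →
    (u 2 * (u 3)⁻¹ * u 1 * (u 2)⁻¹ * (x 2 * (x 3)⁻¹ * x 1 * (x 2)⁻¹)⁻¹) ^ 2 = 1
  odd : 4 ≤ n →
    ((u 2)⁻¹ * u 3 * (u 1)⁻¹ * u 2 * ((x 2)⁻¹ * x 3 * (x 1)⁻¹ * x 2)⁻¹) ^ 2 = 1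

namespace CosetRelations

variable {n : ℕ} {x u : ℕ → K}

theorem reducedRelations (h : CosetRelations n x u) :
    ReducedRelations n (swap : Equiv.Perm (Bool × Bool × K))
      (fun i => flip fun b => if b then u i else x i) where
  a_sq := swap_mul_self
  r_sq _ _ _ := flip_mul_self _
  r_comm i j hi hij hj := flip_commute fun b => by
    cases b
    · exact h.x_sq i j hi hij hj
    · exact h.u_sq i j hi hij hj
  r_braid i hi hn := flip_braid fun b => by
    cases b
    · exact h.x_cube i hi hn
    · exact h.u_cube i hi hn
  ar_comm j hj hn := swap_commute_flip (h.x_eq_u j hj hn)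
  aa_comm hn := by
    rw [flip_four]
    refine swap_commute_conj_diag fun a => ?_
    cases a
    · exact h.even hn
    · exact h.odd hn

end CosetRelations

end CosetAction

/-! ### Identifying `K` with the commutator subgroup -/

theorem signRelations (n : ℕ) :
    ReducedRelations n ((-1, 1) : ℤˣ × ℤˣ) (fun _ => (1, -1)) where
  a_sq := by decide
  r_sq _ _ _ := by decide
  r_comm _ _ _ _ _ := Commute.all _ _
  r_braid _ _ _ := rfl
  ar_comm _ _ _ := Commute.all _ _
  aa_comm _ := Commute.all _ _

/-- The signs of the coset labels. -/
def labelSign {K : Type*} (p : Bool × Bool × K) : ℤˣ × ℤˣ :=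
  (if p.1 then -1 else 1, if p.2.1 then -1 else 1)

namespace CosetRelations

variable {K : Type*} [Group K] {n : ℕ} {x u : ℕ → K}

theorem labelSign_lift (h : CosetRelations n x u) (hn : 1 ≤ 1 ∧ 1 < n) (g : VT n)
    (p : Bool × Bool × K) :
    labelSign (h.reducedRelations.lift g p) = (signRelations n).lift g * labelSign p := by
  induction g using induction_generators hn with
  | one => simp
  | s_mul g ih =>
    rw [map_mul, map_mul, ReducedRelations.lift_s, ReducedRelations.lift_s, mul_assoc, ← ih,
      Equiv.Perm.mul_apply]
    obtain ⟨b, a, k⟩ := h.reducedRelations.lift g p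
    cases b <;> simp [labelSign]
  | ρ_mul i hi g ih =>
    rw [map_mul, map_mul, ReducedRelations.lift_ρ, ReducedRelations.lift_ρ, mul_assoc, ← ih,
      Equiv.Perm.mul_apply]
    obtain ⟨b, a, k⟩ := h.reducedRelations.lift g p
    cases a <;> cases b <;> simp [labelSign]

/-- The element of `VT_n` represented by a coset label and an element of `K`. -/
def toVT (hn : 1 ≤ 1 ∧ 1 < n) (φ : K →* VT n) (p : Bool × Bool × K) : VT n :=
  (if p.1 then s 1 hn else 1) * (if p.2.1 then ρ 1 hn else 1) * φ p.2.2

/-- The formulas for `swap` and `flip` were read off from left multiplication on `s_1^b ρ_1^a φ(k)`,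
so `toVT` is equivariant; on generators this is cancellation of involutions. -/
theorem toVT_lift (h : CosetRelations n x u) (hn : 1 ≤ 1 ∧ 1 < n) (φ : K →* VT n)
    (hx : ∀ i hi, φ (x i) = ρ i hi * ρ 1 hn)
    (hu : ∀ i hi, φ (u i) = s 1 hn * ρ i hi * s 1 hn * ρ 1 hn)
    (g : VT n) (p : Bool × Bool × K) :
    toVT hn φ (h.reducedRelations.lift g p) = g * toVT hn φ p := by
  have cs (g : VT n) : s 1 hn * (s 1 hn * g) = g := by rw [← mul_assoc, s_mul_self, one_mul]
  have cρ (i hi) (g : VT n) : ρ i hi * (ρ i hi * g) = g := by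
    rw [← mul_assoc, ρ_mul_self, one_mul]
  induction g using induction_generators hn with
  | one => simp
  | s_mul g ih =>
    rw [map_mul, ReducedRelations.lift_s, mul_assoc, ← ih, Equiv.Perm.mul_apply]
    obtain ⟨b, a, k⟩ := h.reducedRelations.lift g p
    cases b <;> simp [toVT, mul_assoc, cs]
  | ρ_mul i hi g ih =>
    rw [map_mul, ReducedRelations.lift_ρ, mul_assoc, ← ih, Equiv.Perm.mul_apply]
    obtain ⟨b, a, k⟩ := h.reducedRelations.lift g p
    cases a <;> cases b <;>
      simp [toVT, mul_assoc, cs, cρ, hx i hi, hu i hi, ρ_inv, s_inv]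

/-- The base sheet carries the left regular action of `K`. On `x i` and `u i` the labels return to
`(false, false)`, and `x 1 = 1` removes the factor contributed by the initial `ρ_1`. -/
theorem lift_apply (h : CosetRelations n x u) (hn : 1 ≤ 1 ∧ 1 < n) (φ : K →* VT n)
    (hx : ∀ i hi, φ (x i) = ρ i hi * ρ 1 hn)
    (hu : ∀ i hi, φ (u i) = s 1 hn * ρ i hi * s 1 hn * ρ 1 hn)
    (hgen : Subgroup.closure {k | ∃ i, (1 ≤ i ∧ i < n) ∧ (k = x i ∨ k = u i)} = ⊤) (k l : K) :
    h.reducedRelations.lift (φ k) (false, false, l) = (false, false, k * l) := by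
  have hk : k ∈ Subgroup.closure {k | ∃ i, (1 ≤ i ∧ i < n) ∧ (k = x i ∨ k = u i)} := by
    rw [hgen]; trivial
  induction hk using Subgroup.closure_induction generalizing l with
  | mem k hk =>
    obtain ⟨i, hi, rfl | rfl⟩ := hk
    · rw [hx i hi]
      simp [ReducedRelations.lift_ρ, h.x_one]
    · rw [hu i hi]
      simp [ReducedRelations.lift_ρ, ReducedRelations.lift_s, h.x_one]
  | one => simp
  | mul k k' _ _ ih ih' => simp [ih, ih', mul_assoc]
  | inv k _ ih =>
    rw [map_inv, map_inv, Equiv.Perm.inv_eq_iff_eq, ih]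
    simp

open scoped commutatorElement in
/-- A homomorphism from a group `K`, generated by elements which satisfy the relations of the
coset action, onto the matching elements of `VT_n` identifies `K` with the commutator subgroup. -/
theorem injective_and_range_eq (h : CosetRelations n x u) (hn : 1 ≤ 1 ∧ 1 < n) (φ : K →* VT n)
    (hx : ∀ i hi, φ (x i) = ρ i hi * ρ 1 hn)
    (hu : ∀ i hi, φ (u i) = s 1 hn * ρ i hi * s 1 hn * ρ 1 hn)
    (hgen : Subgroup.closure {k | ∃ i, (1 ≤ i ∧ i < n) ∧ (k = x i ∨ k = u i)} = ⊤) :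
    Function.Injective φ ∧ φ.range = commutator (VT n) := by
  refine ⟨fun k k' hk => ?_, le_antisymm ?_ fun g hg => ?_⟩
  · have e := h.lift_apply hn φ hx hu hgen k 1
    rw [hk, h.lift_apply hn φ hx hu hgen k' 1] at e
    simpa using e.symm
  · rw [MonoidHom.range_eq_map, ← hgen, MonoidHom.map_closure, Subgroup.closure_le]
    rintro _ ⟨k, ⟨i, hi, rfl | rfl⟩, rfl⟩
    · rw [hx i hi]; exact ρ_mul_ρ_one_mem_commutator hn i hi
    · rw [hu i hi]
      have e : s 1 hn * ρ i hi * s 1 hn * ρ 1 hn = ⁅s 1 hn, ρ i hi⁆ * (ρ i hi * ρ 1 hn) := by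
        rw [commutatorElement_def, s_inv]; group
      rw [e]
      exact Subgroup.mul_mem _ (Subgroup.commutator_mem_commutator (Subgroup.mem_top _) (Subgroup.mem_top _))
        (ρ_mul_ρ_one_mem_commutator hn i hi)
  · have e1 := h.toVT_lift hn φ hx hu g (false, false, 1)
    have e2 := h.labelSign_lift hn g (false, false, 1)
    -- The sign group is abelian, so `g` returns the base point to the label `(false, false)`;
    -- equivariance then reads `g = φ k`.
    have e3 : (signRelations n).lift g = 1 :=
      Abelianization.commutator_subset_ker _ hg
    rw [e3] at e2
    generalize h.reducedRelations.lift g (false, false, 1) = p at e1 e2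
    obtain ⟨b, a, k⟩ := p
    cases a <;> cases b <;> simp [labelSign] at e2
    exact ⟨k, by simpa [toVT] using e1⟩

end CosetRelations

end VT
-- The generators `x_i`, `z`, `w` and their relators
namespace VTCommGen

open VT

variable {n : ℕ}

section Values

variable {R : Set (FreeGroup (VTCommGen n))}

/-- The value on the coset `b = false` of the coset action of `ρ_i`. -/
def xValue (R : Set (FreeGroup (VTCommGen n))) (i : ℕ) : PresentedGroup R :=
  if h : 2 ≤ i ∧ i < n then PresentedGroup.of (x ⟨i, h⟩) else 1

/-- The value on the coset `b = true` of the coset action of `ρ_i`. -/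
def uValue (R : Set (FreeGroup (VTCommGen n))) (i : ℕ) : PresentedGroup R :=
  if i = 1 then (PresentedGroup.of w)⁻¹
  else if i = 2 then PresentedGroup.of z * (PresentedGroup.of w)⁻¹ else xValue R i

theorem xValue_one : xValue R 1 = 1 := by simp [xValue]

theorem xValue_of (i : ℕ) (h : 2 ≤ i ∧ i < n) : xValue R i = PresentedGroup.of (x ⟨i, h⟩) := by
  simp [xValue, h]

theorem uValue_one : uValue R 1 = (PresentedGroup.of w)⁻¹ := by simp [uValue]

theorem uValue_two : uValue R 2 = PresentedGroup.of z * (PresentedGroup.of w)⁻¹ := by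
  simp [uValue]

theorem uValue_of (i : ℕ) (h : 3 ≤ i) : uValue R i = xValue R i := by
  rw [uValue, if_neg (by omega), if_neg (by omega)]

theorem closure_values (hn : 3 ≤ n) :
    Subgroup.closure {k | ∃ i, (1 ≤ i ∧ i < n) ∧ (k = xValue R i ∨ k = uValue R i)} = ⊤ := by
  rw [eq_top_iff, ← PresentedGroup.closure_range_of, Subgroup.closure_le]
  set C := Subgroup.closure {k | ∃ i, (1 ≤ i ∧ i < n) ∧ (k = xValue R i ∨ k = uValue R i)}
  have hw : (PresentedGroup.of w : PresentedGroup R) ∈ C := by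
    rw [← inv_mem_iff, ← uValue_one]
    exact Subgroup.subset_closure ⟨1, by omega, Or.inr rfl⟩
  rintro _ ⟨⟨i, hi⟩ | _ | _, rfl⟩
  · rw [← xValue_of]
    exact Subgroup.subset_closure ⟨i, by omega, Or.inl rfl⟩
  · have : uValue R 2 ∈ C := Subgroup.subset_closure ⟨2, by omega, Or.inr rfl⟩
    rw [uValue_two] at this
    simpa using C.mul_mem this hw
  · exact hw

end Values

theorem s_cancel (hn : 1 ≤ 1 ∧ 1 < n) (g : VT n) : VT.s 1 hn * (VT.s 1 hn * g) = g := by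
  rw [← mul_assoc, s_mul_self, one_mul]

theorem ρ_cancel (i : ℕ) (hi : 1 ≤ i ∧ i < n) (g : VT n) : VT.ρ i hi * (VT.ρ i hi * g) = g := by
  rw [← mul_assoc, ρ_mul_self, one_mul]

theorem s_ρ_s_cancel (hn : 1 ≤ 1 ∧ 1 < n) (i : ℕ) (hi : 1 ≤ i ∧ i < n) (h3 : 3 ≤ i) (g : VT n) :
    VT.s 1 hn * (VT.ρ i hi * (VT.s 1 hn * g)) = VT.ρ i hi * g := by
  rw [← mul_assoc, (s_ρ_comm 1 i hn hi h3).eq, mul_assoc, s_cancel]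

/-- Relators which hold in `VT_n` and imply the relations of the coset action present the
commutator subgroup. -/
theorem hasPresentation (hn : 3 ≤ n) (R : Set (FreeGroup (VTCommGen n)))
    (hR : ∀ r ∈ R, FreeGroup.lift (toVT n hn) r = 1)
    (h : CosetRelations n (xValue R) (uValue R)) :
    (commutator (VT n)).HasPresentation (toVT n hn) R := by
  have hn1 : 1 ≤ 1 ∧ 1 < n := by omega
  let φ : PresentedGroup R →* VT n := PresentedGroup.toGroup hR
  have hof (a) : φ (PresentedGroup.of a) = toVT n hn a := PresentedGroup.toGroup.of hR
  have hx : ∀ i hi, φ (xValue R i) = VT.ρ i hi * VT.ρ 1 hn1 := by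
    intro i hi
    obtain rfl | h2 : i = 1 ∨ 2 ≤ i := by omega
    · rw [xValue_one, map_one, ρ_mul_self]
    · rw [xValue_of i ⟨h2, hi.2⟩, hof]; rfl
  have hu : ∀ i hi, φ (uValue R i) = VT.s 1 hn1 * VT.ρ i hi * VT.s 1 hn1 * VT.ρ 1 hn1 := by
    intro i hi
    obtain rfl | rfl | h3 : i = 1 ∨ i = 2 ∨ 3 ≤ i := by omega
    · rw [uValue_one, map_inv, hof]
      simp [toVT, pow_two, mul_assoc, s_inv, ρ_inv]
    · rw [uValue_two, map_mul, map_inv, hof, hof]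
      simp [toVT, pow_two, mul_assoc, s_inv, ρ_inv, s_cancel, ρ_cancel]
    · rw [uValue_of i h3, hx i hi]
      simp only [mul_assoc, s_ρ_s_cancel hn1 i hi h3]
  obtain ⟨hinj, hrange⟩ := h.injective_and_range_eq hn1 φ hx hu (closure_values hn)
  exact ⟨(MonoidHom.ofInjective hinj).trans (MulEquiv.subgroupCongr hrange), hof⟩

theorem ρ_mul_ρ_pow_two (i j : ℕ) (hi : 1 ≤ i ∧ i < n) (hj : 1 ≤ j ∧ j < n) (h : i + 2 ≤ j) :
    (VT.ρ i hi * VT.ρ j hj) ^ 2 = 1 := by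
  rw [(ρ_comm i j hi hj h).mul_pow, pow_two, pow_two, ρ_mul_self, ρ_mul_self, one_mul]

theorem ρ_mul_ρ_pow_three (i : ℕ) (hi : 1 ≤ i ∧ i < n) (hj : 1 ≤ i + 1 ∧ i + 1 < n) :
    (VT.ρ i hi * VT.ρ (i + 1) hj) ^ 3 = 1 := by
  have : (VT.ρ i hi * VT.ρ (i + 1) hj) ^ 3 =
      (VT.ρ i hi * VT.ρ (i + 1) hj * VT.ρ i hi) *
        (VT.ρ (i + 1) hj * VT.ρ i hi * VT.ρ (i + 1) hj) := by
    simp only [pow_succ, pow_zero, one_mul, mul_assoc]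
  rw [this, ρ_braid i hi hj]
  simp [mul_assoc, ρ_cancel, ρ_mul_self]

theorem conj_s_pow_eq_one (hn : 1 ≤ 1 ∧ 1 < n) {g : VT n} {m : ℕ} (h : g ^ m = 1) :
    (VT.s 1 hn * g * VT.s 1 hn) ^ m = 1 := by
  have := conj_pow (a := VT.s 1 hn) (b := g) (i := m)
  rw [s_inv] at this
  rw [this, h, mul_one, s_mul_self]

theorem conj_ρ_pow_eq_one (hn : 1 ≤ 1 ∧ 1 < n) {g : VT n} {m : ℕ} (h : g ^ m = 1) :
    (VT.ρ 1 hn * g * VT.ρ 1 hn) ^ m = 1 := by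
  have := conj_pow (a := VT.ρ 1 hn) (b := g) (i := m)
  rw [ρ_inv] at this
  rw [this, h, mul_one, ρ_mul_self]

theorem s_one_mul_s_three_pow_two (hn : 4 ≤ n) :
    (VT.s 1 (by omega) * VT.s 3 (by omega) : VT n) ^ 2 = 1 := by
  rw [(s_comm 1 3 _ _ (by omega)).mul_pow, pow_two, pow_two, s_mul_self, s_mul_self, one_mul]

theorem s_three (hn : 4 ≤ n) :
    (VT.s 3 (by omega) : VT n) = VT.ρ 2 * VT.ρ 3 * VT.ρ 1 * VT.ρ 2 * VT.s 1 * VT.ρ 2 * VT.ρ 1 *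
      VT.ρ 3 * VT.ρ 2 := by
  rw [s_succ 2 (by omega) (by omega), s_succ 1 (by omega) (by omega)]
  simp only [mul_inv_rev, ρ_inv, mul_assoc]

theorem x_two_pow_three (hn : 3 ≤ n) : (VT.ρ 2 * VT.ρ 1 : VT n) ^ 3 = 1 := by
  have := ρ_mul_ρ_pow_three (n := n) 1 (by omega) (by omega)
  rw [← inv_inj, ← inv_pow, inv_one, mul_inv_rev, ρ_inv, ρ_inv]
  exact this

theorem lift_x_pow_three (hn : 3 ≤ n) :
    FreeGroup.lift (toVT n hn) (X 2 ^ 3) = 1 := by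
  rw [map_pow, X, FreeGroup.lift_apply_of]
  exact x_two_pow_three hn

theorem lift_z_pow_three (hn : 3 ≤ n) :
    FreeGroup.lift (toVT n hn) (Z ^ 3) = 1 := by
  rw [map_pow, Z, FreeGroup.lift_apply_of]
  simpa only [toVT, mul_assoc] using conj_s_pow_eq_one (by omega) (x_two_pow_three hn)

/-- Up to inversion, each base telescopes to a familiar word: `x_i x_j⁻¹ = ρ_i ρ_j`, while `x_j w`
and `z w⁻¹ x_j⁻¹` give the `s_1`-conjugates of `ρ_1 ρ_j` and `ρ_2 ρ_j`. The last two bases are `s_1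
s_3` and its conjugate by `ρ_1`. -/
theorem lift_relator (hn : 4 ≤ n) (hn' : 3 ≤ n) (r : FreeGroup (VTCommGen n))
    (hr : IsRelator n hn r) : FreeGroup.lift (toVT n hn') r = 1 := by
  cases hr with
  | rel1 => exact lift_x_pow_three _
  | rel2 j h3 hj =>
    rw [map_pow, X, FreeGroup.lift_apply_of, ← inv_inj, ← inv_pow, inv_one]
    simpa [toVT, ρ_inv] using ρ_mul_ρ_pow_two 1 j (by omega) (by omega) h3
  | rel3 => exact lift_z_pow_three _
  | rel4 i h2 hi =>
    rw [map_pow, map_mul, map_inv, X, X, FreeGroup.lift_apply_of, FreeGroup.lift_apply_of]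
    simpa [toVT, ρ_inv, mul_assoc, ρ_cancel] using
      ρ_mul_ρ_pow_three i (by omega) (by omega)
  | rel5 i j h2 hij hj =>
    rw [map_pow, map_mul, map_inv, X, X, FreeGroup.lift_apply_of, FreeGroup.lift_apply_of]
    simpa [toVT, ρ_inv, mul_assoc, ρ_cancel] using
      ρ_mul_ρ_pow_two i j (by omega) (by omega) hij
  | rel6 j h3 hj =>
    have := conj_s_pow_eq_one (n := n) (by omega)
      (ρ_mul_ρ_pow_two 1 j (by omega) (by omega) (by omega))
    rw [map_pow, map_mul, X, W, FreeGroup.lift_apply_of, FreeGroup.lift_apply_of,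
      ← inv_inj, ← inv_pow, inv_one]
    rw [← this]
    congr 1
    simp [toVT, pow_two, s_inv, ρ_inv, mul_assoc, ρ_cancel,
      (s_ρ_comm (n := n) 1 j (by omega) (by omega) (by omega)).eq]
  | rel7 =>
    have := conj_s_pow_eq_one (n := n) (by omega)
      (ρ_mul_ρ_pow_three 2 (by omega) (by omega))
    simp only [map_pow, map_mul, map_inv, X, Z, W, FreeGroup.lift_apply_of]
    rw [← this]
    congr 1
    simp [toVT, pow_two, s_inv, ρ_inv, mul_assoc, ρ_cancel, s_cancel,
      (s_ρ_comm (n := n) 1 3 (by omega) (by omega) (by omega)).eq]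
  | rel8 j h4 hj =>
    have := conj_s_pow_eq_one (n := n) (by omega)
      (ρ_mul_ρ_pow_two 2 j (by omega) (by omega) (by omega))
    simp only [map_pow, map_mul, map_inv, X, Z, W, FreeGroup.lift_apply_of]
    rw [← this]
    congr 1
    simp [toVT, pow_two, s_inv, ρ_inv, mul_assoc, ρ_cancel, s_cancel,
      (s_ρ_comm (n := n) 1 j (by omega) (by omega) (by omega)).eq]
  | rel9 =>
    simp only [map_pow, map_mul, map_inv, X, Z, W, FreeGroup.lift_apply_of]
    rw [← s_one_mul_s_three_pow_two hn, s_three hn]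
    congr 1
    simp [toVT, pow_two, s_inv, ρ_inv, mul_assoc, ρ_cancel, s_cancel,
      s_ρ_s_cancel (n := n) (by omega) 3 (by omega) le_rfl]
  | rel10 =>
    simp only [map_pow, map_mul, map_inv, X, Z, W, FreeGroup.lift_apply_of]
    rw [← conj_ρ_pow_eq_one (by omega) (s_one_mul_s_three_pow_two hn), s_three hn]
    congr 1
    simp [toVT, pow_two, s_inv, ρ_inv, mul_assoc, ρ_cancel, s_cancel,
      s_ρ_s_cancel (n := n) (by omega) 3 (by omega) le_rfl]

theorem cosetRelations_three (h : 2 ≤ 2 ∧ 2 < 3) :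
    CosetRelations 3 (xValue {X 2 h ^ 3, Z ^ 3}) (uValue {X 2 h ^ 3, Z ^ 3}) where
  x_one := xValue_one
  x_eq_u _ _ _ := by omega
  x_sq _ _ _ _ _ := by omega
  u_sq _ _ _ _ _ := by omega
  x_cube i hi hn := by
    obtain rfl : i = 1 := by omega
    rw [xValue_one, one_mul, inv_pow, inv_eq_one, xValue_of 2 (by omega)]
    exact PresentedGroup.one_of_mem (Set.mem_insert _ _)
  u_cube i hi hn := by
    obtain rfl : i = 1 := by omega
    -- Here `u_1 u_2⁻¹ = w⁻¹ (z w⁻¹)⁻¹ = z⁻¹`, so the cube condition is `z³ = 1`.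
    rw [uValue_one, uValue_two, ← inv_inj, ← inv_pow, inv_one]
    have h3 : (PresentedGroup.of z : PresentedGroup {X 2 h ^ 3, Z ^ 3}) ^ 3 = 1 :=
      PresentedGroup.one_of_mem (Set.mem_insert_of_mem _ (Set.mem_singleton _))
    simpa using h3
  even _ := by omega
  odd _ := by omega

theorem cosetRelations (hn : 4 ≤ n) :
    CosetRelations n (xValue {r | IsRelator n hn r}) (uValue {r | IsRelator n hn r}) := by
  have one {r} (hr : IsRelator n hn r) : PresentedGroup.mk {r | IsRelator n hn r} r = 1 :=
    PresentedGroup.one_of_mem hr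
  have x5 : ∀ i j, 2 ≤ i → i + 2 ≤ j → j < n →
      (xValue {r | IsRelator n hn r} i * (xValue {r | IsRelator n hn r} j)⁻¹) ^ 2 = 1 := by
    intro i j hi hij hj
    rw [xValue_of i (by omega), xValue_of j (by omega)]
    exact one (.rel5 i j hi hij hj)
  have x4 : ∀ i, 2 ≤ i → i + 1 < n →
      (xValue {r | IsRelator n hn r} i * (xValue {r | IsRelator n hn r} (i + 1))⁻¹) ^ 3 = 1 := by
    intro i hi hj
    rw [xValue_of i (by omega), xValue_of (i + 1) (by omega)]
    exact one (.rel4 i hi hj)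
  refine ⟨xValue_one, fun j h3 hj => (uValue_of j h3).symm, ?_, ?_, ?_, ?_, ?_, ?_⟩
  · intro i j hi hij hj
    obtain rfl | hi : i = 1 ∨ 2 ≤ i := by omega
    · rw [xValue_one, one_mul, inv_pow, inv_eq_one, xValue_of j (by omega)]
      exact one (.rel2 j hij hj)
    · exact x5 i j hi hij hj
  · intro i j hi hij hj
    rw [uValue_of j (by omega)]
    obtain rfl | rfl | hi : i = 1 ∨ i = 2 ∨ 3 ≤ i := by omega
    · rw [uValue_one, ← mul_inv_rev, inv_pow, inv_eq_one, xValue_of j (by omega)]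
      exact one (.rel6 j hij hj)
    · rw [uValue_two, xValue_of j (by omega)]
      exact one (.rel8 j hij hj)
    · rw [uValue_of i hi]
      exact x5 i j (by omega) hij hj
  · intro i hi hj
    obtain rfl | hi : i = 1 ∨ 2 ≤ i := by omega
    · rw [xValue_one, one_mul, inv_pow, inv_eq_one, xValue_of 2 (by omega)]
      exact one .rel1
    · exact x4 i hi hj
  · intro i hi hj
    obtain rfl | rfl | hi : i = 1 ∨ i = 2 ∨ 3 ≤ i := by omega
    · rw [uValue_one, uValue_two, ← inv_inj, ← inv_pow, inv_one]
      have h3 : (PresentedGroup.of z : PresentedGroup {r | IsRelator n hn r}) ^ 3 = 1 := one .rel3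
      simpa using h3
    · rw [uValue_two, uValue_of 3 le_rfl, xValue_of 3 (by omega)]
      exact one .rel7
    · rw [uValue_of i hi, uValue_of (i + 1) (by omega)]
      exact x4 i (by omega) hj
  · intro _
    rw [uValue_one, uValue_two, uValue_of 3 le_rfl, xValue_one, xValue_of 2 (by omega),
      xValue_of 3 (by omega)]
    refine Eq.trans ?_ (one .rel9)
    rw [map_pow]
    congr 1
    -- The factor `u_1 u_2⁻¹` collapses to `z⁻¹`, giving `rel9`; in the odd case below there is no
    -- such cancellation, and the word is already `rel10`.
    simp only [map_mul, map_inv, mul_assoc, mul_inv_rev, inv_inv, one_mul,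
      inv_mul_cancel_left]
    rfl
  · intro _
    rw [uValue_one, uValue_two, uValue_of 3 le_rfl, xValue_one, xValue_of 2 (by omega),
      xValue_of 3 (by omega)]
    refine Eq.trans ?_ (one .rel10)
    rw [map_pow]
    congr 1

end VTCommGen
-- The case `n = 3` and the free product
namespace VTCommGen

open Monoid

/-- The homomorphism from the cyclic group of order three sending the generator to `g`. -/
def zmodThreeHom {G : Type*} [Group G] (g : G) (h : g ^ 3 = 1) : Multiplicative (ZMod 3) →* G :=
  AddMonoidHom.toMultiplicativeLeft
    (ZMod.lift 3 ⟨zmultiplesHom (Additive G) (Additive.ofMul g), by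
      rw [zmultiplesHom_apply, natCast_zsmul, ← ofMul_pow, h, ofMul_one]⟩)

theorem zmodThreeHom_ofAdd_one {G : Type*} [Group G] (g : G) (h : g ^ 3 = 1) :
    zmodThreeHom g h (Multiplicative.ofAdd 1) = g := by
  have : (1 : ZMod 3) = ((1 : ℤ) : ZMod 3) := by simp
  simp only [zmodThreeHom, AddMonoidHom.toMultiplicativeLeft_apply_apply, toAdd_ofAdd]
  rw [this, ZMod.lift_coe]
  simp

theorem zmodThree_hom_ext {G : Type*} [Group G] {f f' : Multiplicative (ZMod 3) →* G}
    (h : f (Multiplicative.ofAdd 1) = f' (Multiplicative.ofAdd 1)) : f = f' := by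
  refine MonoidHom.ext fun m => ?_
  have : m = Multiplicative.ofAdd 1 ^ (Multiplicative.toAdd m).val := by
    rw [← ofAdd_nsmul, nsmul_one, ZMod.natCast_zmod_val, ofAdd_toAdd]
  rw [this, map_pow, map_pow, h]

/-- The free product `ℤ/3 * ℤ/3 * ℤ`. -/
abbrev FreeProductThree : Type :=
  Coprod (Coprod (Multiplicative (ZMod 3)) (Multiplicative (ZMod 3))) (Multiplicative ℤ)

/-- The images in `ℤ/3 * ℤ/3 * ℤ` of the generators of the presentation for `n = 3`. -/
def toFreeProduct : VTCommGen 3 → FreeProductThree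
  | x _ => Coprod.inl (Coprod.inl (Multiplicative.ofAdd 1))
  | z => Coprod.inl (Coprod.inr (Multiplicative.ofAdd 1))
  | w => Coprod.inr (Multiplicative.ofAdd 1)

theorem lift_toFreeProduct (h : 2 ≤ 2 ∧ 2 < 3) (r : FreeGroup (VTCommGen 3))
    (hr : r ∈ ({X 2 h ^ 3, Z ^ 3} : Set (FreeGroup (VTCommGen 3)))) :
    FreeGroup.lift toFreeProduct r = 1 := by
  have h3 : (Multiplicative.ofAdd (1 : ZMod 3)) ^ 3 = 1 := by decide
  rcases hr with rfl | rfl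
  · rw [map_pow, X, FreeGroup.lift_apply_of, toFreeProduct, ← map_pow, ← map_pow, h3, map_one,
      map_one]
  · rw [map_pow, Z, FreeGroup.lift_apply_of, toFreeProduct, ← map_pow, ← map_pow, h3, map_one,
      map_one]

theorem of_x_pow_three (h : 2 ≤ 2 ∧ 2 < 3) :
    (PresentedGroup.of (x ⟨2, h⟩) : PresentedGroup {X 2 h ^ 3, Z ^ 3}) ^ 3 = 1 :=
  PresentedGroup.one_of_mem (Set.mem_insert _ _)

theorem of_z_pow_three (h : 2 ≤ 2 ∧ 2 < 3) :
    (PresentedGroup.of z : PresentedGroup {X 2 h ^ 3, Z ^ 3}) ^ 3 = 1 :=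
  PresentedGroup.one_of_mem (Set.mem_insert_of_mem _ (Set.mem_singleton _))

/-- The group `⟨x, z, w ∣ x³ = z³ = 1⟩` is `ℤ/3 * ℤ/3 * ℤ`. -/
def presentedEquivFreeProduct (h : 2 ≤ 2 ∧ 2 < 3) :
    PresentedGroup {X 2 h ^ 3, Z ^ 3} ≃* FreeProductThree :=
  MonoidHom.toMulEquiv (PresentedGroup.toGroup (lift_toFreeProduct h))
    (Coprod.lift
      (Coprod.lift (zmodThreeHom _ (of_x_pow_three h)) (zmodThreeHom _ (of_z_pow_three h)))
      (zpowersHom _ (PresentedGroup.of w)))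
    (by
      refine PresentedGroup.ext fun a => ?_
      rw [MonoidHom.comp_apply, PresentedGroup.toGroup.of, MonoidHom.id_apply]
      obtain ⟨i, hi⟩ | _ | _ := a
      · obtain rfl : i = 2 := by omega
        rw [toFreeProduct, Coprod.lift_apply_inl, Coprod.lift_apply_inl, zmodThreeHom_ofAdd_one]
      · rw [toFreeProduct, Coprod.lift_apply_inl, Coprod.lift_apply_inr, zmodThreeHom_ofAdd_one]
      · rw [toFreeProduct, Coprod.lift_apply_inr, zpowersHom_apply]
        simp)
    (by
      refine Coprod.hom_ext (Coprod.hom_ext ?_ ?_) ?_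
      · apply zmodThree_hom_ext (G := FreeProductThree)
        simp only [MonoidHom.comp_apply, MonoidHom.id_apply, Coprod.lift_apply_inl,
          zmodThreeHom_ofAdd_one, PresentedGroup.toGroup.of, toFreeProduct]
      · apply zmodThree_hom_ext (G := FreeProductThree)
        simp only [MonoidHom.comp_apply, MonoidHom.id_apply, Coprod.lift_apply_inl,
          Coprod.lift_apply_inr, zmodThreeHom_ofAdd_one, PresentedGroup.toGroup.of, toFreeProduct]
      · apply MonoidHom.ext_mint (M := FreeProductThree)
        simp only [MonoidHom.comp_apply, MonoidHom.id_apply, Coprod.lift_apply_inr,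
          zpowersHom_apply, toAdd_ofAdd, zpow_one, PresentedGroup.toGroup.of, toFreeProduct])

theorem hasPresentation_three (h : 2 ≤ 2 ∧ 2 < 3) (hn : 3 ≤ 3) :
    (commutator (VT 3)).HasPresentation (toVT 3 hn) {X 2 h ^ 3, Z ^ 3} := by
  refine hasPresentation hn _ (fun r hr => ?_) (cosetRelations_three h)
  rcases hr with rfl | rfl
  · exact lift_x_pow_three _
  · exact lift_z_pow_three _

end VTCommGen

/-! ### The case `n = 2` -/

namespace VT

/-- Only `x 1 = 1` has content. The value `-1` comes from `u_1 = w⁻¹`, with `w` corresponding to `1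
∈ ℤ`. -/
theorem cosetRelations_two : CosetRelations 2 (fun _ => (1 : Multiplicative ℤ))
    (fun _ => Multiplicative.ofAdd (-1)) where
  x_one := rfl
  x_eq_u _ _ _ := by omega
  x_sq _ _ _ _ _ := by omega
  u_sq _ _ _ _ _ := by omega
  x_cube _ _ _ := by omega
  u_cube _ _ _ := by omega
  even _ := by omega
  odd _ := by omega

theorem zpowersHom_injective_and_range_eq (h : 1 ≤ 1 ∧ 1 < 2) :
    Function.Injective (zpowersHom (VT 2) ((ρ 1 h * s 1 h) ^ 2)) ∧
      (zpowersHom (VT 2) ((ρ 1 h * s 1 h) ^ 2)).range = commutator (VT 2) := by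
  refine cosetRelations_two.injective_and_range_eq h _ (fun i hi => ?_)
    (fun i hi => ?_) ?_
  · obtain rfl : i = 1 := by omega
    rw [map_one, ρ_mul_self]
  · obtain rfl : i = 1 := by omega
    simp [zpowersHom_apply, pow_two, s_inv, ρ_inv, mul_assoc]
  · rw [eq_top_iff]
    intro k _
    have hmem : Multiplicative.ofAdd (-1 : ℤ) ∈ Subgroup.closure
        {k : Multiplicative ℤ | ∃ i, (1 ≤ i ∧ i < 2) ∧ (k = 1 ∨ k = Multiplicative.ofAdd (-1))} :=
      Subgroup.subset_closure ⟨1, by omega, Or.inr rfl⟩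
    have e : k = Multiplicative.ofAdd (-1 : ℤ) ^ (-Multiplicative.toAdd k) := by
      rw [← ofAdd_zsmul]; simp
    rw [e]
    exact Subgroup.zpow_mem _ hmem _

end VT

theorem mainTheorem2 :
    (Nonempty (commutator (VT 2) ≃* Multiplicative ℤ) ∧
      commutator (VT 2) = Subgroup.zpowers ((VT.ρ 1 * VT.s 1 : VT 2) ^ 2)) ∧
    (Nonempty (commutator (VT 3) ≃*
        Monoid.Coprod (Monoid.Coprod (Multiplicative (ZMod 3)) (Multiplicative (ZMod 3)))
          (Multiplicative ℤ)) ∧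
      (commutator (VT 3)).HasPresentation (VTCommGen.toVT 3 le_rfl)
        {VTCommGen.X 2 ^ 3, VTCommGen.Z ^ 3}) ∧
    (∀ (n : ℕ) (hn : 4 ≤ n),
      (commutator (VT n)).HasPresentation (VTCommGen.toVT n (by omega))
        {r | VTCommGen.IsRelator n hn r}) := by

  refine ⟨⟨?_, ?_⟩, ⟨?_, VTCommGen.hasPresentation_three _ _⟩, fun n hn =>
    VTCommGen.hasPresentation _ _ (VTCommGen.lift_relator hn _) (VTCommGen.cosetRelations hn)⟩
  · obtain ⟨hinj, hrange⟩ := VT.zpowersHom_injective_and_range_eq (by omega)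
    exact ⟨((MonoidHom.ofInjective hinj).trans (MulEquiv.subgroupCongr hrange)).symm⟩
  · rw [← (VT.zpowersHom_injective_and_range_eq _).2]
    ext g
    rw [MonoidHom.mem_range, Subgroup.mem_zpowers_iff]
    rfl
  · obtain ⟨e, -⟩ := VTCommGen.hasPresentation_three (by omega) le_rfl
    exact ⟨e.symm.trans (VTCommGen.presentedEquivFreeProduct _)⟩
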